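/- Let $\mathcal G=\overline{\mathbb Q}^\times/\operatorname{Tor}(\overline{\mathbb Q}^\times)$, a $\mathbb Q$-vector space written multiplicatively, on which $G=\operatorname{Gal}(\overline{\mathbb Q}/\mathbb Q)$ acts, and let $\delta(\beta)=\#\{\sigma\beta:\sigma\in G\}$ for $\beta\in\mathcal G$. Let $K\subset\overline{\mathbb Q}$ be a finite Galois extension of $\mathbb Q$ with set of places $M_K$, and let $V_K\subset\mathcal G$ be the $\mathbb Q$-subspace spanned by the classes of elements of $K^\times$. For $v\in M_K$ let $\|\cdot\|_v$ be the absolute value extending the usual one of $\mathbb Q$ below $v$; it extends to $V_K$ by $\|\beta^r\|_v=\|\beta\|_v^r$ for $r\in\mathbb Q$. For $\beta\in V_K$ let $$h_1(\beta)=\sum_{v\in M_K}\frac{[K_v:\mathbb Q_v]}{[K:\mathbb Q]}\,\bigl|\log\|\beta\|_v\bigr| .$$ Let $\alpha\in V_K$, and let $S\subset M_K$ consist of the archimedean places of $K$, the places $v$ with $\|\alpha\|_v\neq1$, and all conjugates of these under $\operatorname{Gal}(K/\mathbb Q)$, which acts on places by $\|\cdot\|_{\sigma v}=\|\sigma^{-1}(\cdot)\|_v$.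 Put $V_{K,S}=\{\beta\in V_K:\|\beta\|_v=1\text{ for all }v\in M_K\setminus S\}$. Then $S$ is finite, contains all archimedean places and is stable under $\operatorname{Gal}(K/\mathbb Q)$, and there exists a $\mathbb Q$-linear projection $P_S:V_K\to V_{K,S}$ (that is, $P_S\beta=\beta$ for all $\beta\in V_{K,S}$) such that for all $\beta\in V_K$: 1. $h_1(P_S\beta)\le h_1(\beta)$; 2. $\delta(P_S\beta)\le\delta(\beta)$, and thus $\delta(P_S\beta)h_1(P_S\beta)\le\delta(\beta)h_1(\beta)$. If moreover $V_{K,S}\neq\{1\}$, then $P_S$ has norm exactly one with respect to both $N=h_1$ and $N=\delta h_1$, that is, $1$ is the least constant $C\ge0$ such that $N(P_S\beta)\le C\,N(\beta)$ for all $\beta\in V_K$. -/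

import Mathlib

open NumberField

noncomputable section

/-- The group `𝒢` of nonzero algebraic numbers modulo torsion (roots of unity).  It is written
additively: the product of classes is `+`, and the power of a class to a rational exponent `r`
is `r • _`. -/
def AlgModTor : Type :=
  Additive ((AlgebraicClosure ℚ)ˣ ⧸ CommGroup.torsion (AlgebraicClosure ℚ)ˣ)

instance : AddCommGroup AlgModTor :=
  inferInstanceAs (AddCommGroup
    (Additive ((AlgebraicClosure ℚ)ˣ ⧸ CommGroup.torsion (AlgebraicClosure ℚ)ˣ)))

instance : IsAddTorsionFree AlgModTor :=
  inferInstanceAs (IsAddTorsionFree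
    (Additive ((AlgebraicClosure ℚ)ˣ ⧸ CommGroup.torsion (AlgebraicClosure ℚ)ˣ)))

/-- The class modulo torsion of a nonzero algebraic number. -/
def algClass : Additive (AlgebraicClosure ℚ)ˣ →+ AlgModTor :=
  MonoidHom.toAdditive (QuotientGroup.mk' (CommGroup.torsion (AlgebraicClosure ℚ)ˣ))

theorem algClass_surjective : Function.Surjective algClass :=
  QuotientGroup.mk'_surjective (CommGroup.torsion (AlgebraicClosure ℚ)ˣ)

theorem algClass_eq_zero_iff (a : (AlgebraicClosure ℚ)ˣ) :
    algClass (Additive.ofMul a) = 0 ↔ IsOfFinOrder a :=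
  QuotientGroup.eq_one_iff (N := CommGroup.torsion (AlgebraicClosure ℚ)ˣ) a

theorem AlgModTor.exists_nsmul_eq {n : ℕ} (hn : n ≠ 0) (x : AlgModTor) :
    ∃ y : AlgModTor, n • y = x := by
  obtain ⟨a, rfl⟩ := algClass_surjective x
  obtain ⟨z, hz⟩ := IsAlgClosed.exists_pow_nat_eq
    ((Additive.toMul a : (AlgebraicClosure ℚ)ˣ) : AlgebraicClosure ℚ) (Nat.pos_of_ne_zero hn)
  have hz0 : z ≠ 0 := by
    rintro rfl
    rw [zero_pow hn] at hz
    exact (Additive.toMul a).ne_zero hz.symm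
  refine ⟨algClass (Additive.ofMul (Units.mk0 z hz0)), ?_⟩
  rw [← map_nsmul]
  congr 1
  apply Additive.toMul.injective
  ext
  simpa using hz

theorem AlgModTor.exists_ratSMul (r : ℚ) (x : AlgModTor) :
    ∃ y : AlgModTor, r.den • y = r.num • x :=
  AlgModTor.exists_nsmul_eq r.den_ne_zero _

/-- The rational power: `r • x` is the unique `y` with `y ^ den r = x ^ num r`
(in multiplicative notation). -/
instance : SMul ℚ AlgModTor :=
  ⟨fun r x => (AlgModTor.exists_ratSMul r x).choose⟩

theorem AlgModTor.den_smul (r : ℚ) (x : AlgModTor) : (r.den : ℤ) • (r • x) = r.num • x := by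
  rw [natCast_zsmul]
  exact (AlgModTor.exists_ratSMul r x).choose_spec

theorem AlgModTor.zsmul_cancel {n : ℤ} (hn : n ≠ 0) {x y : AlgModTor} (h : n • x = n • y) :
    x = y :=
  zsmul_right_injective hn h

theorem AlgModTor.smul_eq_of {r : ℚ} {x y : AlgModTor} {m k : ℤ} (hm : m ≠ 0)
    (hr : r * m = k) (h : m • y = k • x) : r • x = y := by
  have hd : (r.den : ℤ) ≠ 0 := by exact_mod_cast r.den_ne_zero
  apply AlgModTor.zsmul_cancel (mul_ne_zero hm hd)
  have hk : m * r.num = r.den * k := by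
    have h1 : r * r.den = r.num := Rat.mul_den_eq_num r
    have : (m : ℚ) * r.num = r.den * k := by rw [← h1, ← hr]; ring
    exact_mod_cast this
  rw [mul_zsmul, AlgModTor.den_smul, ← mul_zsmul, hk, mul_comm m, mul_zsmul, mul_zsmul, h]

instance : Module ℚ AlgModTor where
  one_smul x := AlgModTor.smul_eq_of (m := 1) (k := 1) one_ne_zero (by norm_num) rfl
  mul_smul r s x := by
    have hr : (r.den : ℤ) ≠ 0 := by exact_mod_cast r.den_ne_zero
    have hs : (s.den : ℤ) ≠ 0 := by exact_mod_cast s.den_ne_zero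
    refine AlgModTor.smul_eq_of (m := r.den * s.den) (k := r.num * s.num)
      (mul_ne_zero hr hs) ?_ ?_
    · have h1 : r * r.den = r.num := Rat.mul_den_eq_num r
      have h2 : s * s.den = s.num := Rat.mul_den_eq_num s
      push_cast
      rw [← h1, ← h2]; ring
    · rw [mul_comm (r.den : ℤ), mul_zsmul, AlgModTor.den_smul, ← mul_zsmul, mul_comm, mul_zsmul,
        AlgModTor.den_smul, ← mul_zsmul]
  smul_zero r := AlgModTor.smul_eq_of (m := r.den) (k := r.num)
    (by exact_mod_cast r.den_ne_zero) (Rat.mul_den_eq_num r) (by simp)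
  smul_add r x y := AlgModTor.smul_eq_of (m := r.den) (k := r.num)
    (by exact_mod_cast r.den_ne_zero) (Rat.mul_den_eq_num r) (by
      rw [zsmul_add, AlgModTor.den_smul, AlgModTor.den_smul, zsmul_add])
  add_smul r s x := by
    have hr : (r.den : ℤ) ≠ 0 := by exact_mod_cast r.den_ne_zero
    have hs : (s.den : ℤ) ≠ 0 := by exact_mod_cast s.den_ne_zero
    refine AlgModTor.smul_eq_of (m := r.den * s.den) (k := s.den * r.num + r.den * s.num)
      (mul_ne_zero hr hs) ?_ ?_
    · have h1 : r * r.den = r.num := Rat.mul_den_eq_num r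
      have h2 : s * s.den = s.num := Rat.mul_den_eq_num s
      push_cast
      rw [← h1, ← h2]; ring
    · have h1 := AlgModTor.den_smul r x
      have h2 := AlgModTor.den_smul s x
      rw [zsmul_add, add_zsmul, mul_zsmul (s • x), h2, mul_comm (r.den : ℤ), mul_zsmul (r • x), h1,
        ← mul_zsmul, ← mul_zsmul]
  zero_smul x := AlgModTor.smul_eq_of (m := 1) (k := 0) one_ne_zero (by norm_num) (by simp)

/-- The action of `σ ∈ Gal(ℚ̄/ℚ)` on algebraic numbers modulo torsion. -/
def galAct (σ : AlgebraicClosure ℚ ≃ₐ[ℚ] AlgebraicClosure ℚ) : AlgModTor →+ AlgModTor :=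
  MonoidHom.toAdditive (QuotientGroup.map _ _
    (Units.map (σ : AlgebraicClosure ℚ →* AlgebraicClosure ℚ)) (CommGroup.le_comap_torsion _))

theorem galAct_algClass (σ : AlgebraicClosure ℚ ≃ₐ[ℚ] AlgebraicClosure ℚ)
    (a : (AlgebraicClosure ℚ)ˣ) :
    galAct σ (algClass (Additive.ofMul a)) =
      algClass (Additive.ofMul (Units.map (σ : AlgebraicClosure ℚ →* AlgebraicClosure ℚ) a)) :=
  rfl

/-- `δ(x)`, the number of elements in the orbit of `x` under `Gal(ℚ̄/ℚ)`. -/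
def orbitSize (x : AlgModTor) : ℕ :=
  (Set.range fun σ : AlgebraicClosure ℚ ≃ₐ[ℚ] AlgebraicClosure ℚ => galAct σ x).ncard

/-- The class modulo torsion of a nonzero element of the subfield `K` of `ℚ̄`. -/
def fieldClass (K : IntermediateField ℚ (AlgebraicClosure ℚ)) : Additive Kˣ →+ AlgModTor :=
  algClass.comp (MonoidHom.toAdditive (Units.map (K.val : K →* AlgebraicClosure ℚ)))

/-- `V_K`, the `ℚ`-vector space spanned by the classes of the nonzero elements of `K`. -/
def fieldSpan (K : IntermediateField ℚ (AlgebraicClosure ℚ)) : Submodule ℚ AlgModTor :=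
  Submodule.span ℚ (Set.range (fieldClass K))

theorem exists_nsmul_eq_fieldClass {K : IntermediateField ℚ (AlgebraicClosure ℚ)}
    (x : fieldSpan K) :
    ∃ (n : ℕ) (a : Additive Kˣ), n ≠ 0 ∧ n • (x : AlgModTor) = fieldClass K a := by
  obtain ⟨x, hx⟩ := x
  change ∃ (n : ℕ) (a : Additive Kˣ), n ≠ 0 ∧ n • x = fieldClass K a
  induction hx using Submodule.span_induction with
  | mem x h =>
    obtain ⟨a, rfl⟩ := h
    exact ⟨1, a, one_ne_zero, one_nsmul _⟩
  | zero => exact ⟨1, 0, one_ne_zero, by simp⟩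
  | add x y _ _ hx hy =>
    obtain ⟨n, a, hn, ha⟩ := hx
    obtain ⟨m, b, hm, hb⟩ := hy
    refine ⟨n * m, m • a + n • b, mul_ne_zero hn hm, ?_⟩
    rw [map_add, map_nsmul, map_nsmul, ← ha, ← hb, nsmul_add, ← mul_nsmul, ← mul_nsmul,
      mul_comm m n]
  | smul r x _ hx =>
    obtain ⟨n, a, hn, ha⟩ := hx
    refine ⟨n * r.den, r.num • a, mul_ne_zero hn r.den_ne_zero, ?_⟩
    rw [map_zsmul, ← ha, mul_comm, mul_nsmul, ← natCast_zsmul _ r.den, AlgModTor.den_smul]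
    simp only [← natCast_zsmul, ← mul_zsmul]
    rw [mul_comm]

section Places

variable (K : Type*) [Field K] [NumberField K]

/-- The set `M_K` of places of `K`: the archimedean and the non-archimedean ones. -/
abbrev Place : Type _ := InfinitePlace K ⊕ FinitePlace K

variable {K}

/-- Mathlib's absolute value representing a place.  For an archimedean place this is
`‖·‖_v`, extending the usual absolute value of `ℚ`; for a finite place it is `x ↦ N(v) ^ (-ord_v x)`,
which is `‖·‖_v ^ [K_v : ℚ_v]` for the absolute value `‖·‖_v` extending the `p`-adic one. -/
def Place.abv : Place K → AbsoluteValue K ℝ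
  | Sum.inl v => v.1
  | Sum.inr v => v.1

/-- The exponent to which `Place.abv` is to be raised to obtain `‖·‖_v ^ [K_v : ℚ_v]`: the local
degree for an archimedean place and `1` for a finite place. -/
def Place.weight : Place K → ℕ
  | Sum.inl v => v.mult
  | Sum.inr _ => 1

/-- `log |a|_v` for `a ∈ Kˣ`, where `|a|_v = ‖a‖_v ^ ([K_v : ℚ_v] / [K : ℚ])`. -/
def Place.logUnit (v : Place K) : Additive Kˣ →+ ℝ where
  toFun a := (v.weight : ℝ) / Module.finrank ℚ K * Real.log (v.abv (Additive.toMul a : Kˣ))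
  map_zero' := by simp
  map_add' a b := by
    rw [toMul_add, Units.val_mul, map_mul, Real.log_mul, mul_add]
    · exact (v.abv.ne_zero_iff).2 (Units.ne_zero _)
    · exact (v.abv.ne_zero_iff).2 (Units.ne_zero _)

end Places

section

variable {K : IntermediateField ℚ (AlgebraicClosure ℚ)} [NumberField K]

theorem Place.logUnit_eq_of_fieldClass_eq (v : Place K) {a b : Additive Kˣ}
    (h : fieldClass K a = fieldClass K b) : v.logUnit a = v.logUnit b := by
  rw [← sub_eq_zero, ← map_sub] at h ⊢
  obtain ⟨n, hn, h1⟩ := isOfFinOrder_iff_pow_eq_one.1 ((algClass_eq_zero_iff _).1 h)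
  have h2 : n • (a - b) = 0 := by
    apply Additive.toMul.injective
    apply Units.map_injective (f := (K.val : K →* AlgebraicClosure ℚ)) K.val.injective
    simpa using h1
  have h3 : n • v.logUnit (a - b) = 0 := by rw [← map_nsmul, h2, map_zero]
  exact (smul_eq_zero.1 h3).resolve_left hn.ne'

/-- `log |x|_v` for `x ∈ V_K` is `(1/n) log |a|_v`, for any `n ≥ 1` and `a ∈ Kˣ` such that
`x ^ n` is the class of `a`. -/
def Place.logAux (v : Place K) (x : fieldSpan K) : ℝ :=
  v.logUnit (exists_nsmul_eq_fieldClass x).choose_spec.choose /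
    (exists_nsmul_eq_fieldClass x).choose

theorem Place.logAux_eq (v : Place K) {x : fieldSpan K} {n : ℕ} {a : Additive Kˣ} (hn : n ≠ 0)
    (h : n • (x : AlgModTor) = fieldClass K a) : v.logAux x = v.logUnit a / n := by
  obtain ⟨hm, h'⟩ := (exists_nsmul_eq_fieldClass x).choose_spec.choose_spec
  unfold Place.logAux
  generalize (exists_nsmul_eq_fieldClass x).choose_spec.choose = b at *
  generalize (exists_nsmul_eq_fieldClass x).choose = m at *
  have h1 : fieldClass K (n • b) = fieldClass K (m • a) := by
    rw [map_nsmul, map_nsmul, ← h, ← h', ← mul_nsmul, ← mul_nsmul, mul_comm]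
  have h2 := v.logUnit_eq_of_fieldClass_eq h1
  rw [map_nsmul, map_nsmul, nsmul_eq_mul, nsmul_eq_mul] at h2
  have hn' : (n : ℝ) ≠ 0 := by exact_mod_cast hn
  have hm' : (m : ℝ) ≠ 0 := by exact_mod_cast hm
  rw [div_eq_div_iff hm' hn']
  linarith

/-- The `ℚ`-linear map `x ↦ log |x|_v` on `V_K`. -/
def Place.logAbs (v : Place K) : fieldSpan K →ₗ[ℚ] ℝ :=
  AddMonoidHom.toRatLinearMap <| AddMonoidHom.mk' v.logAux fun x y => by
    obtain ⟨n, a, hn, ha⟩ := exists_nsmul_eq_fieldClass x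
    obtain ⟨m, b, hm, hb⟩ := exists_nsmul_eq_fieldClass y
    have h : (n * m) • ((x + y : fieldSpan K) : AlgModTor) = fieldClass K (m • a + n • b) := by
      rw [map_add, map_nsmul, map_nsmul, ← ha, ← hb, Submodule.coe_add, nsmul_add, ← mul_nsmul,
        ← mul_nsmul, mul_comm m n]
    rw [v.logAux_eq (mul_ne_zero hn hm) h, v.logAux_eq hn ha, v.logAux_eq hm hb, map_add,
      map_nsmul, map_nsmul, nsmul_eq_mul, nsmul_eq_mul]
    have hn' : (n : ℝ) ≠ 0 := by exact_mod_cast hn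
    have hm' : (m : ℝ) ≠ 0 := by exact_mod_cast hm
    push_cast
    field_simp

theorem Place.logAbs_eq (v : Place K) {x : fieldSpan K} {n : ℕ} {a : Additive Kˣ} (hn : n ≠ 0)
    (h : n • (x : AlgModTor) = fieldClass K a) : v.logAbs x = v.logUnit a / n :=
  v.logAux_eq hn h

/-- The Weil height `h₁(x) = ∑_v |log |x|_v| = ∑_v [K_v : ℚ_v] / [K : ℚ] * |log ‖x‖_v|` of
`x ∈ V_K`; all but finitely many terms vanish. -/
def weilHeight (x : fieldSpan K) : ℝ :=
  ∑ᶠ v : Place K, |v.logAbs x|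

/-- The Mahler-type function `δ(x) h₁(x)` on `V_K`. -/
def mahlerHeight (x : fieldSpan K) : ℝ :=
  orbitSize (x : AlgModTor) * weilHeight x

/-- `IsConjPlace u v`: the place `u` is `σ v` for some `σ ∈ Gal(K/ℚ)`, where
`‖y‖_{σ v} = ‖σ⁻¹ y‖_v`. -/
def IsConjPlace (u v : Place K) : Prop :=
  ∃ σ : K ≃ₐ[ℚ] K, ∀ y : K, u.abv y = v.abv (σ⁻¹ y)

/-- The set of places of `K` consisting of the archimedean places, the support of `x` (the places
where `x` has nontrivial valuation), and the Galois conjugates of all these. -/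
def placeSet (x : fieldSpan K) : Set (Place K) :=
  {u | ∃ v : Place K, (v.isLeft ∨ v.logAbs x ≠ 0) ∧ IsConjPlace u v}

/-- `V_{K,S}`, the subspace of those `x ∈ V_K` with `‖x‖_v = 1` at all places `v ∉ S`. -/
def sUnitSpan (S : Set (Place K)) : Submodule ℚ (fieldSpan K) :=
  ⨅ v ∈ Sᶜ, LinearMap.ker v.logAbs

theorem mem_sUnitSpan {S : Set (Place K)} {x : fieldSpan K} :
    x ∈ sUnitSpan S ↔ ∀ v : Place K, v ∉ S → v.logAbs x = 0 := by
  simp [sUnitSpan]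

/-- `c` is the operator norm of `P` with respect to the function `N` on `V_K`: the least
constant `C ≥ 0` such that `N (P x) ≤ C * N x` for all `x`. -/
def IsOperatorNorm {S : Set (Place K)} (N : fieldSpan K → ℝ)
    (P : fieldSpan K →ₗ[ℚ] sUnitSpan S) (c : ℝ) : Prop :=
  IsLeast {C : ℝ | 0 ≤ C ∧ ∀ x : fieldSpan K, N (P x) ≤ C * N x} c

end

end

/-!
For a finite place `w` of `K`, finiteness of the class group and Dirichlet's unit theorem provide
`e ∈ Kˣ` with `|e|_w < 1`, `|e|_u = 1` at all other finite places and `|e|_v ≥ 1` at all archimedean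
ones. As `log |·|_w` takes its values on `V_K` in a rational line, every `x ∈ V_K` can be divided by
a rational power of `e` so as to become a unit at `w`. This does not increase `h₁`: by the product
formula `∑ v, log |e|_v = 0`, the decrease of `|log |x|_w|` pays for whatever is added at the
archimedean places. Doing so at all `w ∉ S` is a linear projection onto `V_{K,S}`. Its average over
`Gal(K/ℚ)` is still one, and it is equivariant, hence it cannot enlarge Galois orbits. The norms are
exactly one because the projection fixes a nonzero element of `V_{K,S}`, where `h₁` is positive by
Kronecker's theorem.
-/

section BiorthogonalSystem

/-- Vectors `vec i` and linear forms `coord i` with `coord i (vec j) = δ_ij`, such that every vector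
has only finitely many nonzero coordinates. In contrast to `Module.DualBases` the coordinates need
not separate points: their common kernel is the subspace to be projected onto. -/
structure BiorthogonalSystem (ι k V : Type*) [CommRing k] [AddCommGroup V] [Module k V] where
  vec : ι → V
  coord : ι → Module.Dual k V
  coord_vec_self (i : ι) : coord i (vec i) = 1
  coord_vec_of_ne {i j : ι} (h : i ≠ j) : coord i (vec j) = 0
  finite_coord_ne_zero (x : V) : {i | coord i x ≠ 0}.Finite

namespace BiorthogonalSystem

variable {ι k V : Type*} [CommRing k] [AddCommGroup V] [Module k V]
  (B : BiorthogonalSystem ι k V)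

/-- The coordinates of a vector, collected in a finitely supported function. -/
noncomputable def coords : V →ₗ[k] ι →₀ k where
  toFun x := Finsupp.ofSupportFinite (fun i => B.coord i x) (B.finite_coord_ne_zero x)
  map_add' x y := Finsupp.ext fun i => map_add (B.coord i) x y
  map_smul' c x := Finsupp.ext fun i => map_smul (B.coord i) c x

theorem coords_apply (x : V) (i : ι) : B.coords x i = B.coord i x :=
  rfl

theorem coord_linearCombination (c : ι →₀ k) (i : ι) :
    B.coord i (Finsupp.linearCombination k B.vec c) = c i := by
  rw [Finsupp.linearCombination_apply, map_finsuppSum, Finsupp.sum_eq_single i]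
  · rw [map_smul, B.coord_vec_self, smul_eq_mul, mul_one]
  · intro j _ hj
    rw [map_smul, B.coord_vec_of_ne hj.symm, smul_zero]
  · intro _
    rw [zero_smul, map_zero]

/-- The projection `x ↦ x - ∑ i, coord i x • vec i` onto the common kernel of the coordinates. -/
noncomputable def kerProj : V →ₗ[k] V :=
  LinearMap.id - Finsupp.linearCombination k B.vec ∘ₗ B.coords

theorem kerProj_apply (x : V) :
    B.kerProj x = x - Finsupp.linearCombination k B.vec (B.coords x) :=
  rfl

theorem isProj_kerProj : LinearMap.IsProj (⨅ i, LinearMap.ker (B.coord i)) B.kerProj where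
  map_mem x := by
    simp only [Submodule.mem_iInf, LinearMap.mem_ker]
    intro i
    rw [kerProj_apply, map_sub, coord_linearCombination, coords_apply, sub_self]
  map_id x hx := by
    simp only [Submodule.mem_iInf, LinearMap.mem_ker] at hx
    have hx0 : B.coords x = 0 := Finsupp.ext hx
    rw [kerProj_apply, hx0, map_zero, sub_zero]

theorem apply_sub_sum_le {β : Type*} [Preorder β] {N : V → β}
    (hN : ∀ i x, N (x - B.coord i x • B.vec i) ≤ N x) (s : Finset ι) (x : V) :
    N (x - ∑ i ∈ s, B.coord i x • B.vec i) ≤ N x := by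
  classical
  induction s using Finset.induction_on with
  | empty => rw [Finset.sum_empty, sub_zero]
  | insert i s hi ih =>
    have hcoord : B.coord i (x - ∑ j ∈ s, B.coord j x • B.vec j) = B.coord i x := by
      rw [map_sub, map_sum, Finset.sum_eq_zero, sub_zero]
      intro j hj
      rw [map_smul, B.coord_vec_of_ne (ne_of_mem_of_not_mem hj hi).symm, smul_zero]
    have hstep := hN i (x - ∑ j ∈ s, B.coord j x • B.vec j)
    rw [hcoord, sub_sub] at hstep
    rw [Finset.sum_insert hi, add_comm]
    exact hstep.trans ih

theorem apply_kerProj_le {β : Type*} [Preorder β] {N : V → β}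
    (hN : ∀ i x, N (x - B.coord i x • B.vec i) ≤ N x) (x : V) : N (B.kerProj x) ≤ N x :=
  B.apply_sub_sum_le hN (B.coords x).support x

end BiorthogonalSystem

theorem exists_dual_smul_eq_of_range_le_span_singleton {k V W : Type*} [Field k] [AddCommGroup V]
    [Module k V] [AddCommGroup W] [Module k W] {f : V →ₗ[k] W} {w : W}
    (hf : LinearMap.range f ≤ k ∙ w) {e : V} (he : f e ≠ 0) :
    ∃ r : Module.Dual k V, ∀ x, r x • f e = f x := by
  have hw : w ∈ k ∙ f e := by
    obtain ⟨c, hc⟩ := Submodule.mem_span_singleton.1 (hf ⟨e, rfl⟩)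
    have hc0 : c ≠ 0 := by
      rintro rfl
      exact he (by rw [← hc, zero_smul])
    exact Submodule.mem_span_singleton.2 ⟨c⁻¹, by rw [← hc, inv_smul_smul₀ hc0]⟩
  have hmem (x : V) : f x ∈ k ∙ f e :=
    (Submodule.span_singleton_le_iff_mem _ _).2 hw (hf ⟨x, rfl⟩)
  exact ⟨(LinearEquiv.coord k W (f e) he).toLinearMap ∘ₗ f.codRestrict _ hmem,
    fun x => LinearEquiv.coord_apply_smul k W (f e) he ⟨f x, hmem x⟩⟩

end BiorthogonalSystem

section Averaging

open Representation

variable {k G V W : Type*} [Field k] [Group G] [Fintype G] [Invertible (Fintype.card G : k)]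
  [AddCommGroup V] [Module k V] [AddCommGroup W] [Module k W]

theorem averageMap_linHom_apply (ρ : Representation k G V) (σ : Representation k G W)
    (f : V →ₗ[k] W) (x : V) :
    averageMap (linHom ρ σ) f x =
      (Fintype.card G : k)⁻¹ • ∑ g : G, σ g (f (ρ g⁻¹ x)) := by
  simp [GroupAlgebra.average, LinearMap.sum_apply]

theorem averageMap_linHom_comm (ρ : Representation k G V) (σ : Representation k G W)
    (f : V →ₗ[k] W) (g : G) (x : V) :
    averageMap (linHom ρ σ) f (ρ g x) = σ g (averageMap (linHom ρ σ) f x) :=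
  ((mem_linHom_invariants_iff_isIntertwining _).1
    (averageMap_invariant (linHom ρ σ) f)).isIntertwining g x

theorem isProj_averageMap_linHom {ρ : Representation k G V} {U : Submodule k V} {f : V →ₗ[k] V}
    (hU : ∀ g, ∀ x ∈ U, ρ g x ∈ U) (hf : LinearMap.IsProj U f) :
    LinearMap.IsProj U (averageMap (linHom ρ ρ) f) where
  map_mem x := by
    rw [averageMap_linHom_apply]
    exact U.smul_mem _ (U.sum_mem fun g _ => hU g _ (hf.map_mem _))
  map_id x hx := by
    have hfix (g : G) : ρ g (f (ρ g⁻¹ x)) = x := by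
      rw [hf.map_id _ (hU g⁻¹ x hx), self_inv_apply]
    rw [averageMap_linHom_apply, Fintype.sum_congr _ _ hfix, Finset.sum_const, Finset.card_univ,
      ← Nat.cast_smul_eq_nsmul k, inv_smul_smul₀ (Invertible.ne_zero _)]

theorem seminorm_averageMap_linHom_le {V : Type*} [AddCommGroup V] [Module ℚ V]
    {ρ : Representation ℚ G V} [Invertible (Fintype.card G : ℚ)] {N : Seminorm ℚ V}
    {f : V →ₗ[ℚ] V} (hρ : ∀ g x, N (ρ g x) = N x)
    (hf : ∀ x, N (f x) ≤ N x) (x : V) : N (averageMap (linHom ρ ρ) f x) ≤ N x := by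
  have hcard : (0 : ℝ) < Fintype.card G := Nat.cast_pos.2 Fintype.card_pos
  have hterm (g : G) : N (ρ g (f (ρ g⁻¹ x))) ≤ N x := by
    rw [hρ, ← hρ g⁻¹ x]
    exact hf _
  calc N (averageMap (linHom ρ ρ) f x)
      = (Fintype.card G : ℝ)⁻¹ * N (∑ g : G, ρ g (f (ρ g⁻¹ x))) := by
        rw [averageMap_linHom_apply, map_smul_eq_mul, norm_inv, ← Rat.norm_cast_real,
          Rat.cast_natCast, Real.norm_natCast]
    _ ≤ (Fintype.card G : ℝ)⁻¹ * ∑ g : G, N (ρ g (f (ρ g⁻¹ x))) := by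
        gcongr
        exact Finset.le_sum_of_subadditive N (map_zero N).le (map_add_le_add N) _ _
    _ ≤ (Fintype.card G : ℝ)⁻¹ * ∑ _g : G, N x := by
        gcongr with g
        exact hterm g
    _ = N x := by
        rw [Finset.sum_const, Finset.card_univ, nsmul_eq_mul, inv_mul_cancel_left₀ hcard.ne']

end Averaging

section RingEquivPlaces

open Ideal IsDedekindDomain

theorem absNorm_map_ringEquiv {R S : Type*} [CommRing R] [IsDedekindDomain R] [Module.Free ℤ R]
    [CommRing S] [IsDedekindDomain S] [Module.Free ℤ S] (e : R ≃+* S) (I : Ideal R) :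
    absNorm (I.map (e : R →+* S)) = absNorm I := by
  rw [absNorm_apply, absNorm_apply, Submodule.cardQuot_apply, Submodule.cardQuot_apply]
  exact Nat.card_congr (quotientEquiv I _ e rfl).symm.toEquiv

theorem multiplicity_map_ringEquiv {R S : Type*} [CommSemiring R] [CommSemiring S]
    (e : R ≃+* S) (I J : Ideal R) :
    multiplicity (I.map (e : R →+* S)) (J.map (e : R →+* S)) = multiplicity I J := by
  have hsymm (L : Ideal R) : (L.map (e : R →+* S)).map (e.symm : S →+* R) = L := by
    rw [map_map, RingEquiv.symm_comp, Ideal.map_id]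
  have hle := le_emultiplicity_map (mapHom (e.symm : S →+* R))
    (a := I.map (e : R →+* S)) (b := J.map (e : R →+* S))
  rw [mapHom_apply, mapHom_apply, hsymm, hsymm] at hle
  exact multiplicity_eq_of_emultiplicity_eq
    (hle.antisymm (le_emultiplicity_map (mapHom (e : R →+* S))))

theorem finitePlace_mk_equivOfRingEquiv_apply {K L : Type*} [Field K] [NumberField K] [Field L]
    [NumberField L] (e : 𝓞 K ≃+* 𝓞 L) (v : HeightOneSpectrum (𝓞 K)) (x : 𝓞 K) :
    FinitePlace.mk (HeightOneSpectrum.equivOfRingEquiv e v) (e x : L) =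
      FinitePlace.mk v (x : K) := by
  rcases eq_or_ne x 0 with rfl | hx
  · simp only [map_zero]
  have hsource := (FinitePlace.mk v).apply_mul_absNorm_pow_eq_one hx
  have htarget := FinitePlace.apply_mul_absNorm_pow_eq_one
    (FinitePlace.mk (HeightOneSpectrum.equivOfRingEquiv e v)) (e.map_ne_zero_iff.2 hx)
  have hideal : (HeightOneSpectrum.equivOfRingEquiv e v).asIdeal =
      v.asIdeal.map (e : 𝓞 K →+* 𝓞 L) := comap_symm e
  have hspan : span {e x} = (span {x}).map (e : 𝓞 K →+* 𝓞 L) := by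
    rw [map_span, Set.image_singleton, RingEquiv.coe_toRingHom]
  rw [FinitePlace.maximalIdeal_mk] at hsource htarget
  rw [hideal, hspan, absNorm_map_ringEquiv, multiplicity_map_ringEquiv] at htarget
  exact mul_right_cancel₀ (right_ne_zero_of_mul_eq_one hsource) (htarget.trans hsource.symm)

end RingEquivPlaces

section GaloisActionOnPlaces

open IsDedekindDomain

variable {k K : Type*} [Field k] [Field K] [NumberField K] [Algebra k K]

/-- The Galois action on finite places by transport of prime ideals. It matches the convention
`‖x‖_{σ w} = ‖σ⁻¹ x‖_w` used for archimedean places, see `smul_finitePlace_apply`. -/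
noncomputable instance : SMul (K ≃ₐ[k] K) (FinitePlace K) where
  smul σ w := FinitePlace.mk <|
    HeightOneSpectrum.equivOfRingEquiv (RingOfIntegers.mapRingEquiv σ.toRingEquiv) w.maximalIdeal

theorem smul_finitePlace_apply (σ : K ≃ₐ[k] K) (w : FinitePlace K) (x : K) :
    (σ • w) x = w (σ⁻¹ x) := by
  have hσ (a : 𝓞 K) : (σ • w) (σ (algebraMap (𝓞 K) K a)) = w (algebraMap (𝓞 K) K a) := by
    have h := finitePlace_mk_equivOfRingEquiv_apply (RingOfIntegers.mapRingEquiv σ.toRingEquiv)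
      w.maximalIdeal a
    rwa [FinitePlace.mk_maximalIdeal] at h
  obtain ⟨y, rfl⟩ := σ.surjective x
  rw [show σ⁻¹ (σ y) = y from σ.symm_apply_apply y]
  obtain ⟨a, b, -, rfl⟩ := IsFractionRing.div_surjective (𝓞 K) y
  rw [map_div₀ σ, map_div₀, map_div₀, hσ, hσ]

noncomputable instance : MulAction (K ≃ₐ[k] K) (FinitePlace K) where
  one_smul w := Subtype.ext <| AbsoluteValue.ext fun x => smul_finitePlace_apply 1 w x
  mul_smul σ τ w := Subtype.ext <| AbsoluteValue.ext fun x => by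
    change (_ : FinitePlace K) x = (_ : FinitePlace K) x
    rw [smul_finitePlace_apply, smul_finitePlace_apply, smul_finitePlace_apply, mul_inv_rev,
      AlgEquiv.mul_apply]

theorem Place.abv_smul (σ : K ≃ₐ[k] K) (v : Place K) (x : K) :
    (σ • v).abv x = v.abv (σ⁻¹ x) :=
  match v with
  | Sum.inl _ => rfl
  | Sum.inr w => smul_finitePlace_apply σ w x

theorem Place.weight_smul (σ : K ≃ₐ[k] K) (v : Place K) : (σ • v).weight = v.weight := by
  classical
  match v with
  | Sum.inl v => exact if_congr InfinitePlace.isReal_smul_iff rfl rfl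
  | Sum.inr _ => rfl

theorem infinitePlace_two_ne_finitePlace_two (u : InfinitePlace K) (v : FinitePlace K) :
    u 2 ≠ v 2 := by
  have hu : u (2 : K) = 2 := InfinitePlace.map_natCast u 2
  have hv : v (2 : K) ≤ 1 := by
    rw [← FinitePlace.norm_embedding_eq]
    exact FinitePlace.norm_le_one K v.maximalIdeal (2 : 𝓞 K)
  linarith

theorem Place.abv_injective : Function.Injective (Place.abv (K := K)) := by
  rintro (u | u) (v | v) h
  · exact congrArg Sum.inl (Subtype.ext h)
  · exact absurd (DFunLike.congr_fun h 2) (infinitePlace_two_ne_finitePlace_two u v)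
  · exact absurd (DFunLike.congr_fun h 2).symm (infinitePlace_two_ne_finitePlace_two v u)
  · exact congrArg Sum.inr (Subtype.ext h)

theorem isConjPlace_iff_mem_orbit {K : IntermediateField ℚ (AlgebraicClosure ℚ)} [NumberField K]
    {u v : Place K} : IsConjPlace u v ↔ u ∈ MulAction.orbit (K ≃ₐ[ℚ] K) v :=
  exists_congr fun σ => by
    rw [← Place.abv_injective.eq_iff, DFunLike.ext_iff]
    simp only [Place.abv_smul, eq_comm]

theorem Place.logUnit_smul (σ : K ≃ₐ[k] K) (v : Place K) (a : Additive Kˣ) :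
    (σ • v).logUnit a =
      v.logUnit (Additive.ofMul (Units.map ((σ⁻¹ : K ≃ₐ[k] K) : K →* K) a.toMul)) := by
  change _ / _ * Real.log _ = _ / _ * Real.log _
  rw [Place.abv_smul, Place.weight_smul]
  rfl

end GaloisActionOnPlaces

section ProductFormula

theorem finsum_sum_type_eq {α β M : Type*} [Fintype α] [AddCommMonoid M] {f : α ⊕ β → M}
    {s : Finset β} (hs : ∀ b ∉ s, f (Sum.inr b) = 0) :
    ∑ᶠ x, f x = ∑ a, f (Sum.inl a) + ∑ b ∈ s, f (Sum.inr b) := by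
  rw [finsum_eq_sum_of_support_subset (s := Finset.univ.disjSum s), Finset.sum_disjSum]
  rintro (a | b) hx
  · exact Finset.inl_mem_disjSum.2 (Finset.mem_univ a)
  · exact Finset.inr_mem_disjSum.2 (by_contra fun hb => hx (hs b hb))

variable {K : Type*} [Field K] [NumberField K]

theorem Place.logUnit_eq_inv_finrank_mul_log (v : Place K) (a : Additive Kˣ) :
    v.logUnit a =
      (Module.finrank ℚ K : ℝ)⁻¹ * Real.log (v.abv (a.toMul : Kˣ) ^ v.weight) := by
  rw [Real.log_pow, ← mul_assoc, ← div_eq_inv_mul]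
  rfl

theorem Place.logUnit_inr (w : FinitePlace K) (a : Additive Kˣ) :
    Place.logUnit (Sum.inr w) a =
      (Module.finrank ℚ K : ℝ)⁻¹ * Real.log (w (a.toMul : Kˣ)) := by
  rw [Place.logUnit_eq_inv_finrank_mul_log]
  exact congrArg (_ * Real.log ·) (pow_one _)

theorem Place.logUnit_eq_zero_iff (v : Place K) (a : Additive Kˣ) :
    v.logUnit a = 0 ↔ v.abv (a.toMul : Kˣ) = 1 := by
  have hweight : v.weight ≠ 0 :=
    match v with
    | Sum.inl v => v.mult_ne_zero
    | Sum.inr _ => one_ne_zero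
  have hpos : 0 < v.abv (a.toMul : Kˣ) := v.abv.pos a.toMul.ne_zero
  rw [Place.logUnit_eq_inv_finrank_mul_log,
    mul_eq_zero_iff_left (inv_ne_zero (Nat.cast_ne_zero.2 Module.finrank_pos.ne')),
    ← Real.log_one, Real.log_injOn_pos.eq_iff (pow_pos hpos _) (Set.mem_Ioi.2 one_pos),
    pow_eq_one_iff_of_nonneg hpos.le hweight]

theorem Place.hasFiniteSupport_logUnit (a : Additive Kˣ) :
    (fun v : Place K => v.logUnit a).HasFiniteSupport := by
  have hfinite := FinitePlace.hasFiniteMulSupport a.toMul.ne_zero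
  refine ((Set.finite_range Sum.inl).union (hfinite.image Sum.inr)).subset ?_
  rintro (v | w) hv
  · exact Or.inl ⟨v, rfl⟩
  · exact Or.inr ⟨w, fun hw => hv ((Place.logUnit_eq_zero_iff _ _).2 hw), rfl⟩

theorem Place.finsum_logUnit (a : Additive Kˣ) : ∑ᶠ v : Place K, v.logUnit a = 0 := by
  have hfinite : (Function.mulSupport fun w : FinitePlace K => w (a.toMul : Kˣ)).Finite :=
    FinitePlace.hasFiniteMulSupport a.toMul.ne_zero
  let s := hfinite.toFinset
  have hout (w : FinitePlace K) (hw : w ∉ s) : Place.logUnit (Sum.inr w) a = 0 :=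
    (Place.logUnit_eq_zero_iff _ _).2 (not_not.1 (hw ∘ hfinite.mem_toFinset.2))
  have hprod : ∏ v ∈ Finset.univ.disjSum s,
      Place.abv v (a.toMul : Kˣ) ^ Place.weight v = 1 := by
    rw [← prod_abs_eq_one a.toMul.ne_zero, finprod_eq_prod_of_mulSupport_subset _
      hfinite.coe_toFinset.ge, Finset.prod_disjSum]
    exact congrArg (_ * ·) (Finset.prod_congr rfl fun w _ => pow_one (w (a.toMul : Kˣ)))
  rw [finsum_sum_type_eq hout, ← Finset.sum_disjSum _ _ fun v : Place K => v.logUnit a]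
  simp only [Place.logUnit_eq_inv_finrank_mul_log]
  rw [← Finset.mul_sum, ← Real.log_prod, hprod, Real.log_one, mul_zero]
  exact fun v _ => pow_ne_zero _ ((Place.abv v).ne_zero a.toMul.ne_zero)

theorem isOfFinOrder_of_logUnit_eq_zero {a : Kˣ}
    (h : ∀ v : Place K, v.logUnit (Additive.ofMul a) = 0) : IsOfFinOrder a := by
  have habv (v : Place K) : v.abv (a : K) = 1 := (v.logUnit_eq_zero_iff _).1 (h v)
  obtain ⟨b, hb⟩ : (a : K) ∈ (algebraMap (𝓞 K) K).range := by
    refine IsDedekindDomain.HeightOneSpectrum.mem_integers_of_valuation_le_one K _ fun p => ?_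
    have hp : FinitePlace.mk p (a : K) = 1 := habv (Sum.inr (FinitePlace.mk p))
    rw [FinitePlace.mk_apply, FinitePlace.norm_embedding'] at hp
    rw [← WithZeroMulInt.toNNReal_le_one_iff (HeightOneSpectrum.one_lt_absNorm_nnreal p)]
    exact_mod_cast hp.le
  have hint : IsIntegral ℤ (a : K) := hb ▸ RingOfIntegers.isIntegral_coe b
  obtain ⟨n, hn, hpow⟩ := Embeddings.pow_eq_one_of_norm_eq_one K ℂ hint
    ((InfinitePlace.eq_iff_eq _ _).1 fun v => habv (Sum.inl v))
  exact isOfFinOrder_iff_pow_eq_one.2 ⟨n, hn, Units.ext hpow⟩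

theorem log_finitePlace_mem_zmultiples (w : FinitePlace K) (x : K) :
    Real.log (w x) ∈
      AddSubgroup.zmultiples (Real.log (Ideal.absNorm w.maximalIdeal.asIdeal)) := by
  rcases eq_or_ne x 0 with rfl | hx
  · rw [map_zero, Real.log_zero]
    exact zero_mem _
  rw [← FinitePlace.norm_embedding_eq, FinitePlace.norm_embedding',
    WithZeroMulInt.toNNReal_neg_apply _ ((Valuation.ne_zero_iff _).2 hx), NNReal.coe_zpow,
    Real.log_zpow, ← zsmul_eq_mul]
  exact AddSubgroup.zsmul_mem_zmultiples _ _

end ProductFormula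

section SingleFinitePlace

variable {K : Type*} [Field K] [NumberField K]

theorem isPrincipal_pow_classNumber {I : Ideal (𝓞 K)} (hI : I ≠ ⊥) :
    (I ^ classNumber K).IsPrincipal := by
  have hpow : (⟨I, mem_nonZeroDivisors_of_ne_zero hI⟩ : nonZeroDivisors (Ideal (𝓞 K))) ^
      classNumber K = ⟨I ^ classNumber K, mem_nonZeroDivisors_of_ne_zero (pow_ne_zero _ hI)⟩ :=
    rfl
  rw [← ClassGroup.mk0_eq_one_iff (mem_nonZeroDivisors_of_ne_zero (pow_ne_zero _ hI)), ← hpow,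
    map_pow, classNumber, pow_card_eq_one]

theorem exists_integer_apply_lt_one_of_finitePlace (w : FinitePlace K) :
    ∃ a : 𝓞 K, a ≠ 0 ∧ w a < 1 ∧ ∀ u : FinitePlace K, u ≠ w → u a = 1 := by
  have hbot : w.maximalIdeal.asIdeal ≠ ⊥ := w.maximalIdeal.ne_bot
  obtain ⟨a, ha⟩ := (isPrincipal_pow_classNumber hbot).principal
  rw [Ideal.submodule_span_eq] at ha
  refine ⟨a, ?_, ?_, fun u hu => ?_⟩
  · rintro rfl
    exact pow_ne_zero _ hbot (ha.trans (Ideal.span_singleton_eq_bot.2 rfl))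
  · rw [← FinitePlace.norm_embedding_eq, FinitePlace.norm_lt_one_iff_mem]
    exact Ideal.pow_le_self (classNumber_ne_zero K) (ha ▸ Ideal.mem_span_singleton_self a)
  · rw [← FinitePlace.norm_embedding_eq, FinitePlace.norm_eq_one_iff_notMem]
    contrapose! hu
    have hle : w.maximalIdeal.asIdeal ≤ u.maximalIdeal.asIdeal :=
      Ideal.IsPrime.le_of_pow_le (ha ▸ (Ideal.span_singleton_le_iff_mem _).2 hu)
    exact FinitePlace.maximalIdeal_injective (IsDedekindDomain.HeightOneSpectrum.ext
      (w.maximalIdeal.isMaximal.eq_of_le u.maximalIdeal.isPrime.ne_top hle)).symm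

theorem finitePlace_apply_unit (w : FinitePlace K) (u : (𝓞 K)ˣ) : w (u : K) = 1 := by
  rw [← FinitePlace.norm_embedding_eq, FinitePlace.norm_eq_one_iff_notMem]
  exact fun h => w.maximalIdeal.isPrime.ne_top (Ideal.eq_top_of_isUnit_mem _ h u.isUnit)

theorem exists_norm_sub_le_of_isZLattice {E : Type*} [NormedAddCommGroup E] [NormedSpace ℝ E]
    [FiniteDimensional ℝ E] (L : Submodule ℤ E) [DiscreteTopology L] [IsZLattice ℝ L] :
    ∃ C, ∀ y : E, ∃ x ∈ L, ‖x - y‖ ≤ C := by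
  have := ZLattice.module_free ℝ L
  have := ZLattice.module_finite ℝ L
  let b := (Module.Free.chooseBasis ℤ L).ofZLatticeBasis ℝ L
  refine ⟨∑ i, ‖b i‖, fun y => ⟨ZSpan.floor b y, ?_, ?_⟩⟩
  · exact (Module.Basis.ofZLatticeBasis_span ℝ L _).le (ZSpan.floor b y).2
  · rw [norm_sub_rev]
    exact ZSpan.norm_fract_le b y

open Units Units.dirichletUnitTheorem in
theorem exists_unit_abs_mult_mul_log_sub_le :
    ∃ C, ∀ y : InfinitePlace K → ℝ, ∑ v, y v = 0 →
      ∃ u : (𝓞 K)ˣ, ∀ v, |v.mult * Real.log (v u) - y v| ≤ C := by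
  classical
  obtain ⟨C, hC⟩ := exists_norm_sub_le_of_isZLattice (unitLattice K)
  let n := Fintype.card {v : InfinitePlace K // v ≠ w₀}
  refine ⟨max C (n * C), fun y hy => ?_⟩
  obtain ⟨-, ⟨u, -, rfl⟩, hu⟩ := hC fun v => y v
  let d (v : InfinitePlace K) : ℝ := v.mult * Real.log (v (u.toMul : (𝓞 K)ˣ)) - y v
  have hne (v : {v : InfinitePlace K // v ≠ w₀}) : |d v| ≤ C := (norm_le_pi_norm _ v).trans hu
  have hsum : d w₀ + ∑ v : {v : InfinitePlace K // v ≠ w₀}, d v = 0 := by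
    rw [← Fintype.sum_eq_add_sum_subtype_ne d w₀, Finset.sum_sub_distrib, sum_mult_mul_log, hy,
      sub_zero]
  refine ⟨u.toMul, fun v => ?_⟩
  by_cases hv : v = w₀
  · calc |d v| = |∑ v : {v : InfinitePlace K // v ≠ w₀}, d v| := by
          rw [hv, eq_neg_of_add_eq_zero_left hsum, abs_neg]
      _ ≤ ∑ v : {v : InfinitePlace K // v ≠ w₀}, |d v| := Finset.abs_sum_le_sum_abs _ _
      _ ≤ n * C := by
          rw [← nsmul_eq_mul]
          exact Finset.sum_le_card_nsmul _ _ _ fun v _ => hne v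
      _ ≤ max C (n * C) := le_max_right _ _
  · exact (hne ⟨v, hv⟩).trans (le_max_left _ _)

theorem exists_unit_mult_mul_log_add_nonneg {l : InfinitePlace K → ℝ} (hl : 0 < ∑ v, l v) :
    ∃ (m : ℕ) (u : (𝓞 K)ˣ), m ≠ 0 ∧ ∀ v, 0 ≤ v.mult * Real.log (v u) + m * l v := by
  obtain ⟨C, hC⟩ := exists_unit_abs_mult_mul_log_sub_le (K := K)
  let n : ℝ := Fintype.card (InfinitePlace K)
  have hn : 0 < n := Nat.cast_pos.2 Fintype.card_pos
  let mean := (∑ v, l v) / n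
  have hmean : 0 < mean := div_pos hl hn
  obtain ⟨m, hm⟩ := exists_nat_ge (C / mean)
  have hsum : ∑ v, ((m + 1 : ℕ) : ℝ) * (mean - l v) = 0 := by
    rw [← Finset.mul_sum, Finset.sum_sub_distrib, Finset.sum_const, Finset.card_univ,
      nsmul_eq_mul, mul_div_cancel₀ _ hn.ne', sub_self, mul_zero]
  obtain ⟨u, hu⟩ := hC _ hsum
  refine ⟨m + 1, u, m.succ_ne_zero, fun v => ?_⟩
  have hv := (abs_le.1 (hu v)).1
  have hCm : C ≤ (m + 1 : ℕ) * mean := by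
    rw [← div_le_iff₀ hmean]
    exact hm.trans (Nat.cast_le.2 m.le_succ)
  linarith

theorem logUnit_inl_unit (v : InfinitePlace K) (u : (𝓞 K)ˣ) :
    Place.logUnit (Sum.inl v) (Additive.ofMul (Units.map (algebraMap (𝓞 K) K).toMonoidHom u)) =
      (Module.finrank ℚ K : ℝ)⁻¹ * (v.mult * Real.log (v u)) := by
  rw [Place.logUnit_eq_inv_finrank_mul_log, Real.log_pow]
  rfl

theorem logUnit_inr_unit (w : FinitePlace K) (u : (𝓞 K)ˣ) :
    Place.logUnit (Sum.inr w) (Additive.ofMul (Units.map (algebraMap (𝓞 K) K).toMonoidHom u)) =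
      0 :=
  (Place.logUnit_eq_zero_iff _ _).2 (finitePlace_apply_unit w u)

theorem exists_logUnit_neg_of_finitePlace (w : FinitePlace K) :
    ∃ a : Additive Kˣ, (∀ v, 0 ≤ Place.logUnit (Sum.inl v) a) ∧ Place.logUnit (Sum.inr w) a < 0 ∧
      ∀ u ≠ w, Place.logUnit (Sum.inr u) a = 0 := by
  have hn : (0 : ℝ) < Module.finrank ℚ K := Nat.cast_pos.2 Module.finrank_pos
  obtain ⟨x, hx0, hxw, hxu⟩ := exists_integer_apply_lt_one_of_finitePlace w
  let b : Additive Kˣ := Additive.ofMul (Units.mk0 (x : K) (RingOfIntegers.coe_ne_zero_iff.2 hx0))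
  have hbw : Place.logUnit (Sum.inr w) b < 0 := by
    rw [Place.logUnit_inr]
    exact mul_neg_of_pos_of_neg (inv_pos.2 hn)
      (Real.log_neg (FinitePlace.pos_iff.2 b.toMul.ne_zero) hxw)
  have hbu (u : FinitePlace K) (hu : u ≠ w) : Place.logUnit (Sum.inr u) b = 0 :=
    (Place.logUnit_eq_zero_iff _ _).2 (hxu u hu)
  have hb : 0 < ∑ v : InfinitePlace K, Module.finrank ℚ K * Place.logUnit (Sum.inl v) b := by
    have hformula := Place.finsum_logUnit b
    rw [finsum_sum_type_eq (s := {w}) fun u hu => hbu u (Finset.notMem_singleton.1 hu),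
      Finset.sum_singleton] at hformula
    rw [← Finset.mul_sum, eq_neg_of_add_eq_zero_left hformula]
    exact mul_pos hn (neg_pos.2 hbw)
  obtain ⟨m, ε, hm, hε⟩ := exists_unit_mult_mul_log_add_nonneg hb
  refine ⟨Additive.ofMul (Units.map (algebraMap (𝓞 K) K).toMonoidHom ε) + m • b,
    fun v => ?_, ?_, fun u hu => ?_⟩
  · rw [map_add, map_nsmul, logUnit_inl_unit, nsmul_eq_mul]
    refine (mul_nonneg (inv_pos.2 hn).le (hε v)).trans_eq ?_
    field_simp
  · rw [map_add, map_nsmul, logUnit_inr_unit, zero_add]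
    exact smul_neg_of_pos_of_neg (Nat.pos_of_ne_zero hm) hbw
  · rw [map_add, map_nsmul, logUnit_inr_unit, hbu u hu, zero_add, smul_zero]

end SingleFinitePlace

section GaloisAction

variable {K : IntermediateField ℚ (AlgebraicClosure ℚ)}

-- The `ℚ`-algebra structures from `AlgebraicClosure` and from characteristic zero agree only
-- propositionally.
instance : Normal ℚ (AlgebraicClosure ℚ) := by
  rw [Subsingleton.elim DivisionRing.toRatAlgebra
    (AlgebraicClosure.instAlgebra ℚ : Algebra ℚ (AlgebraicClosure ℚ))]
  infer_instance

theorem galAct_one (x : AlgModTor) : galAct 1 x = x := by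
  obtain ⟨a, rfl⟩ := algClass_surjective x
  rfl

theorem galAct_mul (σ τ : AlgebraicClosure ℚ ≃ₐ[ℚ] AlgebraicClosure ℚ) (x : AlgModTor) :
    galAct (σ * τ) x = galAct σ (galAct τ x) := by
  obtain ⟨a, rfl⟩ := algClass_surjective x
  rfl

theorem galAct_fieldClass {τ : AlgebraicClosure ℚ ≃ₐ[ℚ] AlgebraicClosure ℚ} {σ : K ≃ₐ[ℚ] K}
    (h : ∀ x : K, τ x = σ x) (a : Additive Kˣ) :
    galAct τ (fieldClass K a) = fieldClass K (Additive.ofMul (Units.map (σ : K →* K) a.toMul)) :=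
  congrArg (algClass ∘ Additive.ofMul) (Units.ext (h _))

theorem galAct_mem_fieldSpan {τ : AlgebraicClosure ℚ ≃ₐ[ℚ] AlgebraicClosure ℚ} {σ : K ≃ₐ[ℚ] K}
    (h : ∀ x : K, τ x = σ x) {x : AlgModTor} (hx : x ∈ fieldSpan K) :
    galAct τ x ∈ fieldSpan K := by
  have hle : fieldSpan K ≤ (fieldSpan K).comap (galAct τ).toRatLinearMap := by
    refine Submodule.span_le.2 ?_
    rintro _ ⟨a, rfl⟩
    exact Submodule.subset_span ⟨_, (galAct_fieldClass h a).symm⟩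
  exact hle hx

theorem galAct_congr {τ τ' : AlgebraicClosure ℚ ≃ₐ[ℚ] AlgebraicClosure ℚ}
    (h : ∀ x : K, τ x = τ' x) (x : fieldSpan K) : galAct τ x = galAct τ' x := by
  obtain ⟨n, a, hn, ha⟩ := exists_nsmul_eq_fieldClass x
  refine nsmul_right_injective hn ?_
  change n • _ = n • _
  rw [← map_nsmul, ← map_nsmul, ha]
  exact congrArg (algClass ∘ Additive.ofMul) (Units.ext (h _))

theorem liftNormal_apply_coe (σ : K ≃ₐ[ℚ] K) (x : K) :
    σ.liftNormal (AlgebraicClosure ℚ) x = σ x :=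
  σ.liftNormal_commutes (AlgebraicClosure ℚ) x

theorem liftNormal_mul_apply_coe (σ τ : K ≃ₐ[ℚ] K) (x : K) :
    (σ * τ).liftNormal (AlgebraicClosure ℚ) x =
      (σ.liftNormal (AlgebraicClosure ℚ) * τ.liftNormal (AlgebraicClosure ℚ)) x := by
  rw [AlgEquiv.mul_apply, liftNormal_apply_coe, liftNormal_apply_coe, liftNormal_apply_coe,
    AlgEquiv.mul_apply]

/-- The action of `Gal(K/ℚ)` on `V_K`, through arbitrary extensions to `Gal(ℚ̄/ℚ)`. -/
noncomputable def fieldRep : Representation ℚ (K ≃ₐ[ℚ] K) (fieldSpan K) where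
  toFun σ := (galAct (σ.liftNormal (AlgebraicClosure ℚ))).toRatLinearMap.restrict
    fun _ => galAct_mem_fieldSpan (liftNormal_apply_coe σ)
  map_one' := LinearMap.ext fun x => Subtype.ext <|
    (galAct_congr (liftNormal_apply_coe 1) x).trans (galAct_one x)
  map_mul' σ τ := LinearMap.ext fun x => Subtype.ext <|
    (galAct_congr (liftNormal_mul_apply_coe σ τ) x).trans (galAct_mul _ _ x)

theorem galAct_eq_fieldRep {τ : AlgebraicClosure ℚ ≃ₐ[ℚ] AlgebraicClosure ℚ} {σ : K ≃ₐ[ℚ] K}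
    (h : ∀ x : K, τ x = σ x) (x : fieldSpan K) : galAct τ x = fieldRep σ x :=
  galAct_congr (fun y => (h y).trans (liftNormal_apply_coe σ y).symm) x

theorem range_galAct [Normal ℚ K] (x : fieldSpan K) :
    (Set.range fun τ : AlgebraicClosure ℚ ≃ₐ[ℚ] AlgebraicClosure ℚ => galAct τ x) =
      Subtype.val '' Set.range fun σ : K ≃ₐ[ℚ] K => fieldRep σ x := by
  rw [← Set.range_comp]
  refine Set.Subset.antisymm ?_ ?_
  · rintro _ ⟨τ, rfl⟩
    exact ⟨τ.restrictNormal K,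
      (galAct_eq_fieldRep (fun y => (τ.restrictNormal_commutes K y).symm) x).symm⟩
  · rintro _ ⟨σ, rfl⟩
    exact ⟨σ.liftNormal _, rfl⟩

theorem orbitSize_eq_ncard_range_fieldRep [Normal ℚ K] (x : fieldSpan K) :
    orbitSize (x : AlgModTor) = (Set.range fun σ : K ≃ₐ[ℚ] K => fieldRep σ x).ncard := by
  rw [orbitSize, range_galAct, Set.ncard_image_of_injective _ Subtype.val_injective]

variable [NumberField K]

theorem orbitSize_pos [Normal ℚ K] (x : fieldSpan K) : 0 < orbitSize (x : AlgModTor) := by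
  rw [orbitSize_eq_ncard_range_fieldRep, Set.ncard_pos (Set.finite_range _)]
  exact Set.range_nonempty _

theorem orbitSize_map_le [Normal ℚ K] {f : fieldSpan K → fieldSpan K}
    (hf : ∀ (σ : K ≃ₐ[ℚ] K) x, f (fieldRep σ x) = fieldRep σ (f x)) (x : fieldSpan K) :
    orbitSize (f x : AlgModTor) ≤ orbitSize (x : AlgModTor) := by
  rw [orbitSize_eq_ncard_range_fieldRep, orbitSize_eq_ncard_range_fieldRep]
  simp only [← hf]
  rw [Set.range_comp' f]
  exact Set.ncard_image_le (Set.finite_range _)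

theorem Place.logAbs_smul (σ : K ≃ₐ[ℚ] K) (v : Place K) (x : fieldSpan K) :
    (σ • v).logAbs x = v.logAbs (fieldRep σ⁻¹ x) := by
  obtain ⟨n, a, hn, ha⟩ := exists_nsmul_eq_fieldClass x
  have hσ : n • (fieldRep σ⁻¹ x : AlgModTor) =
      fieldClass K (Additive.ofMul (Units.map ((σ⁻¹ : K ≃ₐ[ℚ] K) : K →* K) a.toMul)) := by
    rw [← galAct_eq_fieldRep (liftNormal_apply_coe σ⁻¹), ← map_nsmul, ha,
      galAct_fieldClass (liftNormal_apply_coe σ⁻¹)]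
  rw [Place.logAbs_eq _ hn ha, Place.logAbs_eq _ hn hσ, Place.logUnit_smul]

end GaloisAction

section Height

variable {K : IntermediateField ℚ (AlgebraicClosure ℚ)} [NumberField K]

theorem Place.hasFiniteSupport_logAbs (x : fieldSpan K) :
    (fun v : Place K => v.logAbs x).HasFiniteSupport := by
  obtain ⟨n, a, hn, ha⟩ := exists_nsmul_eq_fieldClass x
  simp only [Place.logAbs_eq _ hn ha]
  exact (Place.hasFiniteSupport_logUnit a).fun_comp (g := (· / (n : ℝ))) (zero_div _)

theorem Place.hasFiniteSupport_abs_logAbs (x : fieldSpan K) :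
    (fun v : Place K => |v.logAbs x|).HasFiniteSupport :=
  (Place.hasFiniteSupport_logAbs x).fun_comp abs_zero

theorem Place.finsum_logAbs (x : fieldSpan K) : ∑ᶠ v : Place K, v.logAbs x = 0 := by
  obtain ⟨n, a, hn, ha⟩ := exists_nsmul_eq_fieldClass x
  simp only [Place.logAbs_eq _ hn ha, div_eq_inv_mul, ← smul_eq_mul]
  rw [← smul_finsum, Place.finsum_logUnit, smul_zero]

theorem Place.logAbs_fieldClass (v : Place K) (a : Additive Kˣ) :
    v.logAbs ⟨fieldClass K a, Submodule.subset_span ⟨a, rfl⟩⟩ = v.logUnit a := by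
  rw [v.logAbs_eq one_ne_zero (one_nsmul _), Nat.cast_one, div_one]

theorem eq_zero_of_logAbs_eq_zero {x : fieldSpan K} (h : ∀ v : Place K, v.logAbs x = 0) :
    x = 0 := by
  obtain ⟨n, a, hn, ha⟩ := exists_nsmul_eq_fieldClass x
  have htorsion : IsOfFinOrder a.toMul := isOfFinOrder_of_logUnit_eq_zero fun v =>
    (div_eq_zero_iff.1 (v.logAbs_eq hn ha ▸ h v)).resolve_right (Nat.cast_ne_zero.2 hn)
  have hclass : fieldClass K a = 0 :=
    (algClass_eq_zero_iff _).2 ((Units.map (K.val : K →* AlgebraicClosure ℚ)).isOfFinOrder htorsion)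
  exact Subtype.ext ((smul_eq_zero.1 (ha.trans hclass)).resolve_left hn)

theorem range_logAbs_finitePlace_le (w : FinitePlace K) :
    LinearMap.range (Place.logAbs (Sum.inr w)) ≤
      ℚ ∙ Real.log (Ideal.absNorm w.maximalIdeal.asIdeal) := by
  rintro _ ⟨x, rfl⟩
  obtain ⟨n, a, hn, ha⟩ := exists_nsmul_eq_fieldClass x
  obtain ⟨k, hk⟩ := AddSubgroup.mem_zmultiples_iff.1
    (log_finitePlace_mem_zmultiples w (a.toMul : Kˣ))
  refine Submodule.mem_span_singleton.2 ⟨(Module.finrank ℚ K : ℚ)⁻¹ * k / n, ?_⟩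
  rw [Place.logAbs_eq _ hn ha, Place.logUnit_inr, ← hk, Rat.smul_def, zsmul_eq_mul]
  push_cast
  ring

theorem weilHeight_pos {x : fieldSpan K} (hx : x ≠ 0) : 0 < weilHeight x := by
  obtain ⟨v, hv⟩ : ∃ v : Place K, v.logAbs x ≠ 0 := by
    contrapose! hx
    exact eq_zero_of_logAbs_eq_zero hx
  exact finsum_pos (fun _ => abs_nonneg _) ⟨v, abs_pos.2 hv⟩
    (Place.hasFiniteSupport_abs_logAbs x)

theorem weilHeight_add_le (x y : fieldSpan K) :
    weilHeight (x + y) ≤ weilHeight x + weilHeight y := by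
  have hx := Place.hasFiniteSupport_abs_logAbs x
  have hy := Place.hasFiniteSupport_abs_logAbs y
  rw [weilHeight, weilHeight, weilHeight, ← finsum_add_distrib hx hy]
  refine finsum_le_finsum' (Place.hasFiniteSupport_abs_logAbs _) (hx.add hy) fun v => ?_
  simp only [map_add]
  exact abs_add_le _ _

theorem weilHeight_smul (r : ℚ) (x : fieldSpan K) :
    weilHeight (r • x) = ‖r‖ * weilHeight x := by
  rw [weilHeight, weilHeight, ← smul_eq_mul, smul_finsum]
  exact finsum_congr fun v => by
    rw [map_smul, Rat.smul_def, abs_mul, smul_eq_mul, ← Rat.norm_cast_real, Real.norm_eq_abs]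

/-- The Weil height as a seminorm on the `ℚ`-vector space `V_K`. -/
noncomputable def weilSeminorm : Seminorm ℚ (fieldSpan K) :=
  Seminorm.of weilHeight weilHeight_add_le weilHeight_smul

theorem weilHeight_fieldRep (σ : K ≃ₐ[ℚ] K) (x : fieldSpan K) :
    weilHeight (fieldRep σ x) = weilHeight x := by
  rw [weilHeight, weilHeight, ← finsum_comp_equiv (MulAction.toPerm σ⁻¹)
    (f := fun v : Place K => |v.logAbs x|)]
  exact finsum_congr fun v => by rw [MulAction.toPerm_apply, Place.logAbs_smul, inv_inv]

end Height

section Projection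

variable {K : IntermediateField ℚ (AlgebraicClosure ℚ)} [NumberField K]

/-- An element `e` of `V_K` with `|e|_w < 1` which is a unit at all other finite places and
satisfies `1 ≤ |e|_v` at all archimedean places. Powers of `e` are used to cancel the absolute value
at `w` of other elements without increasing their height. -/
structure IsPseudouniformizer (w : FinitePlace K) (e : fieldSpan K) : Prop where
  logAbs_infinitePlace_nonneg (v : InfinitePlace K) : 0 ≤ Place.logAbs (Sum.inl v) e
  logAbs_neg : Place.logAbs (Sum.inr w) e < 0
  logAbs_of_ne {u : FinitePlace K} (h : u ≠ w) : Place.logAbs (Sum.inr u) e = 0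

theorem exists_isPseudouniformizer (w : FinitePlace K) : ∃ e, IsPseudouniformizer w e := by
  obtain ⟨a, hinf, hw, hu⟩ := exists_logUnit_neg_of_finitePlace w
  simp only [← Place.logAbs_fieldClass] at hinf hw hu
  exact ⟨_, hinf, hw, fun {u} h => hu u h⟩

namespace IsPseudouniformizer

variable {w : FinitePlace K} {e x : fieldSpan K} {r : ℚ}

theorem abs_logAbs_sub_smul_le (he : IsPseudouniformizer w e)
    (hr : r • Place.logAbs (Sum.inr w) e = Place.logAbs (Sum.inr w) x) (v : Place K) :
    |v.logAbs (x - r • e)| ≤ |v.logAbs x| + |(r : ℝ)| * v.logAbs e := by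
  rw [map_sub, map_smul]
  rcases v with v | u
  · rw [Rat.smul_def]
    refine (abs_sub _ _).trans_eq ?_
    rw [abs_mul, abs_of_nonneg (he.logAbs_infinitePlace_nonneg v)]
  · obtain rfl | hu := eq_or_ne u w
    · rw [hr, sub_self, ← hr, Rat.smul_def, abs_mul, abs_of_neg he.logAbs_neg, abs_zero, mul_neg,
        neg_add_cancel]
    · rw [he.logAbs_of_ne hu, smul_zero, sub_zero, mul_zero, add_zero]

theorem weilHeight_sub_smul_le (he : IsPseudouniformizer w e)
    (hr : r • Place.logAbs (Sum.inr w) e = Place.logAbs (Sum.inr w) x) :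
    weilHeight (x - r • e) ≤ weilHeight x := by
  have hx := Place.hasFiniteSupport_abs_logAbs x
  have he' : (fun v : Place K => |(r : ℝ)| * v.logAbs e).HasFiniteSupport :=
    (Place.hasFiniteSupport_logAbs e).fun_comp (mul_zero _)
  calc weilHeight (x - r • e)
      ≤ ∑ᶠ v : Place K, (|v.logAbs x| + |(r : ℝ)| * v.logAbs e) :=
        finsum_le_finsum' (Place.hasFiniteSupport_abs_logAbs _) (hx.add he')
          (he.abs_logAbs_sub_smul_le hr)
    _ = weilHeight x + |(r : ℝ)| * ∑ᶠ v : Place K, v.logAbs e := by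
        rw [finsum_add_distrib hx he', ← smul_eq_mul, smul_finsum]
        rfl
    _ = weilHeight x := by rw [Place.finsum_logAbs, mul_zero, add_zero]

end IsPseudouniformizer

theorem exists_biorthogonalSystem_isPseudouniformizer (T : Set (FinitePlace K)) :
    ∃ B : BiorthogonalSystem T ℚ (fieldSpan K), ∀ w : T, IsPseudouniformizer w.1 (B.vec w) ∧
      ∀ x, B.coord w x • Place.logAbs (Sum.inr w.1) (B.vec w) = Place.logAbs (Sum.inr w.1) x := by
  choose e he using exists_isPseudouniformizer (K := K)
  choose r hr using fun w => exists_dual_smul_eq_of_range_le_span_singleton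
    (range_logAbs_finitePlace_le w) (he w).logAbs_neg.ne
  have hr0 {w : FinitePlace K} {x : fieldSpan K} (hx : Place.logAbs (Sum.inr w) x = 0) :
      r w x = 0 :=
    (smul_eq_zero.1 ((hr w x).trans hx)).resolve_right (he w).logAbs_neg.ne
  exact ⟨{
    vec := fun w => e w
    coord := fun w => r w
    coord_vec_self := fun w => smul_left_injective ℚ (he w).logAbs_neg.ne <|
      (hr w (e w)).trans (one_smul ℚ _).symm
    coord_vec_of_ne := fun h => hr0 ((he _).logAbs_of_ne (Subtype.coe_ne_coe.2 h))
    finite_coord_ne_zero := fun x =>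
      ((Place.hasFiniteSupport_logAbs x).preimage
        (Sum.inr_injective.comp Subtype.val_injective).injOn).subset fun _ hw h => hw (hr0 h) },
    fun w => ⟨he w, hr w⟩⟩

theorem exists_isProj_sUnitSpan_weilHeight_le {S : Set (Place K)}
    (hS : ∀ v : InfinitePlace K, Sum.inl v ∈ S) :
    ∃ P : fieldSpan K →ₗ[ℚ] fieldSpan K, LinearMap.IsProj (sUnitSpan S) P ∧
      ∀ x, weilHeight (P x) ≤ weilHeight x := by
  obtain ⟨B, hB⟩ := exists_biorthogonalSystem_isPseudouniformizer {w | Sum.inr w ∉ S}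
  have hcoord (w : {w | Sum.inr w ∉ S}) (x : fieldSpan K) :
      B.coord w x = 0 ↔ Place.logAbs (Sum.inr w.1) x = 0 := by
    rw [← (hB w).2 x, smul_eq_zero_iff_left (hB w).1.logAbs_neg.ne]
  have hker : ⨅ w, LinearMap.ker (B.coord w) = sUnitSpan S := by
    ext x
    simp only [Submodule.mem_iInf, LinearMap.mem_ker, hcoord, mem_sUnitSpan]
    exact ⟨fun h v hv => match v with
      | Sum.inl v => absurd (hS v) hv
      | Sum.inr w => h ⟨w, hv⟩, fun h w => h _ w.2⟩
  exact ⟨B.kerProj, hker ▸ B.isProj_kerProj,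
    B.apply_kerProj_le fun w x => (hB w).1.weilHeight_sub_smul_le ((hB w).2 x)⟩

theorem fieldRep_mem_sUnitSpan {S : Set (Place K)}
    (hS : ∀ u v : Place K, v ∈ S → IsConjPlace u v → u ∈ S) (σ : K ≃ₐ[ℚ] K) {x : fieldSpan K}
    (hx : x ∈ sUnitSpan S) : fieldRep σ x ∈ sUnitSpan S := by
  refine mem_sUnitSpan.2 fun v hv => ?_
  have hconj : IsConjPlace v (σ⁻¹ • v) :=
    isConjPlace_iff_mem_orbit.2 ⟨σ, smul_inv_smul σ v⟩
  have hlog := Place.logAbs_smul σ⁻¹ v x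
  rw [inv_inv] at hlog
  exact hlog ▸ mem_sUnitSpan.1 hx _ fun h => hv (hS _ _ h hconj)

theorem exists_equivariant_isProj_sUnitSpan_weilHeight_le {S : Set (Place K)}
    (hinf : ∀ v : InfinitePlace K, Sum.inl v ∈ S)
    (hconj : ∀ u v : Place K, v ∈ S → IsConjPlace u v → u ∈ S) :
    ∃ P : fieldSpan K →ₗ[ℚ] fieldSpan K, LinearMap.IsProj (sUnitSpan S) P ∧
      (∀ x, weilHeight (P x) ≤ weilHeight x) ∧
      ∀ (σ : K ≃ₐ[ℚ] K) x, P (fieldRep σ x) = fieldRep σ (P x) := by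
  obtain ⟨Q, hQ, hQh⟩ := exists_isProj_sUnitSpan_weilHeight_le hinf
  have : Invertible (Fintype.card (K ≃ₐ[ℚ] K) : ℚ) :=
    invertibleOfNonzero (Nat.cast_ne_zero.2 Fintype.card_ne_zero)
  exact ⟨Representation.averageMap (Representation.linHom fieldRep fieldRep) Q,
    isProj_averageMap_linHom (fun σ _ => fieldRep_mem_sUnitSpan hconj σ) hQ,
    seminorm_averageMap_linHom_le (N := weilSeminorm) weilHeight_fieldRep hQh,
    averageMap_linHom_comm _ _ Q⟩

theorem isOperatorNorm_one {S : Set (Place K)} {N : fieldSpan K → ℝ}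
    {P : fieldSpan K →ₗ[ℚ] sUnitSpan S} (hP : ∀ x : sUnitSpan S, P (x : fieldSpan K) = x)
    (hle : ∀ x : fieldSpan K, N (P x) ≤ N x) (hpos : ∀ x ≠ 0, 0 < N x)
    (hS : sUnitSpan S ≠ ⊥) : IsOperatorNorm N P 1 := by
  refine ⟨⟨zero_le_one, fun x => (hle x).trans_eq (one_mul _).symm⟩, fun C hC => ?_⟩
  obtain ⟨x, hx, hx0⟩ := Submodule.exists_mem_ne_zero_of_ne_bot hS
  have hCx := hC.2 x
  rw [hP ⟨x, hx⟩] at hCx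
  exact (le_mul_iff_one_le_left (hpos x hx0)).1 hCx

end Projection

section PlaceSet

variable {K : IntermediateField ℚ (AlgebraicClosure ℚ)} [NumberField K]

theorem inl_mem_placeSet (x : fieldSpan K) (v : InfinitePlace K) : Sum.inl v ∈ placeSet x :=
  ⟨Sum.inl v, Or.inl rfl, 1, fun _ => rfl⟩

theorem mem_placeSet_of_isConjPlace {x : fieldSpan K} {u v : Place K} (hv : v ∈ placeSet x)
    (huv : IsConjPlace u v) : u ∈ placeSet x := by
  obtain ⟨w, hw, hvw⟩ := hv
  rw [isConjPlace_iff_mem_orbit] at huv hvw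
  rw [MulAction.orbit_eq_iff.2 hvw] at huv
  exact ⟨w, hw, isConjPlace_iff_mem_orbit.2 huv⟩

theorem finite_placeSet (x : fieldSpan K) : (placeSet x).Finite := by
  have hbase : {v : Place K | v.isLeft ∨ v.logAbs x ≠ 0}.Finite := by
    refine Set.Finite.union ((Set.finite_range Sum.inl).subset fun v hv => ?_)
      (Place.hasFiniteSupport_logAbs x)
    exact (Sum.isLeft_iff.1 hv).imp fun _ => Eq.symm
  refine (hbase.biUnion fun v _ => Set.finite_range fun σ : K ≃ₐ[ℚ] K => σ • v).subset ?_
  rintro u ⟨v, hv, huv⟩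
  exact Set.mem_biUnion hv (isConjPlace_iff_mem_orbit.1 huv)

end PlaceSet

theorem mainTheorem7_general (K : IntermediateField ℚ (AlgebraicClosure ℚ)) [NumberField K]
    [IsGalois ℚ K] {S : Set (Place K)} (hinf : ∀ v : InfinitePlace K, Sum.inl v ∈ S)
    (hconj : ∀ u v : Place K, v ∈ S → IsConjPlace u v → u ∈ S) :
    ∃ P : fieldSpan K →ₗ[ℚ] sUnitSpan S,
      (∀ β : sUnitSpan S, P (β : fieldSpan K) = β) ∧
      (∀ β : fieldSpan K, weilHeight (P β : fieldSpan K) ≤ weilHeight β) ∧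
      (∀ β : fieldSpan K,
        orbitSize ((P β : fieldSpan K) : AlgModTor) ≤ orbitSize (β : AlgModTor)) ∧
      (∀ β : fieldSpan K, mahlerHeight (P β : fieldSpan K) ≤ mahlerHeight β) ∧
      (sUnitSpan S ≠ ⊥ →
        IsOperatorNorm weilHeight P 1 ∧ IsOperatorNorm mahlerHeight P 1) := by
  obtain ⟨P, hP, hheight, hcomm⟩ :=
    exists_equivariant_isProj_sUnitSpan_weilHeight_le hinf hconj
  have hproj (β : sUnitSpan S) : hP.codRestrict (β : fieldSpan K) = β :=
    hP.codRestrict_apply_cod β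
  have horbit (β : fieldSpan K) : orbitSize (P β : AlgModTor) ≤ orbitSize (β : AlgModTor) :=
    orbitSize_map_le hcomm β
  have hmahler (β : fieldSpan K) : mahlerHeight (P β) ≤ mahlerHeight β :=
    mul_le_mul (Nat.cast_le.2 (horbit β)) (hheight β) (apply_nonneg weilSeminorm _)
      (Nat.cast_nonneg _)
  have hmahler_pos (β : fieldSpan K) (hβ : β ≠ 0) : 0 < mahlerHeight β :=
    mul_pos (Nat.cast_pos.2 (orbitSize_pos β)) (weilHeight_pos hβ)
  exact ⟨hP.codRestrict, hproj, hheight, horbit, hmahler, fun hS =>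
    ⟨isOperatorNorm_one hproj hheight (fun _ => weilHeight_pos) hS,
      isOperatorNorm_one hproj hmahler hmahler_pos hS⟩⟩

theorem mainTheorem7 (K : IntermediateField ℚ (AlgebraicClosure ℚ)) [NumberField K]
    [IsGalois ℚ K] (α : fieldSpan K) :
    (placeSet α).Finite ∧
    (∀ v : InfinitePlace K, (Sum.inl v : Place K) ∈ placeSet α) ∧
    (∀ u v : Place K, v ∈ placeSet α → IsConjPlace u v → u ∈ placeSet α) ∧
    ∃ P : fieldSpan K →ₗ[ℚ] sUnitSpan (placeSet α),
      (∀ β : sUnitSpan (placeSet α), P (β : fieldSpan K) = β) ∧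
      (∀ β : fieldSpan K, weilHeight (P β : fieldSpan K) ≤ weilHeight β) ∧
      (∀ β : fieldSpan K,
        orbitSize ((P β : fieldSpan K) : AlgModTor) ≤ orbitSize (β : AlgModTor)) ∧
      (∀ β : fieldSpan K, mahlerHeight (P β : fieldSpan K) ≤ mahlerHeight β) ∧
      (sUnitSpan (placeSet α) ≠ ⊥ →
        IsOperatorNorm weilHeight P 1 ∧ IsOperatorNorm mahlerHeight P 1) :=
  ⟨finite_placeSet α, inl_mem_placeSet α, fun _ _ => mem_placeSet_of_isConjPlace,
    mainTheorem7_general K (inl_mem_placeSet α) fun _ _ => mem_placeSet_of_isConjPlace⟩
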